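/- **Conventions.** Let $X$ be a topological space. *Multimetrics.* A multimetric on $X$ is a family $\mathcal D$ of pseudometrics $d:X\times X\to\mathbb R$ such that for all distinct $x,y\in X$ there is $d\in\mathcal D$ with $d(x,y)>0$. A family $\mathcal D$ of pseudometrics on a set $Y$ generates the topology $\mathcal T_{\mathcal D}$ on $Y$ of all sets $U$ such that for every $x\in U$ there are $\varepsilon>0$ and a finite $\mathcal G\subset\mathcal D$ with $\{y: d(x,y)<\varepsilon\text{ for all }d\in\mathcal G\}\subset U$. A multimetric $\mathcal D$ on $X$ is admissible if $\mathcal T_{\mathcal D}$ is the topology of $X$, and directed if for every nonempty finite $\mathcal G\subset\mathcal D$ there is $d\in\mathcal D$ with $d\ge\max\mathcal G$. *Compact fuzzy sets.* $\mathcal K_{\mathcal F}(X)$ is the set of all upper semicontinuous $u:X\to[0,1]$ that attain the value $1$ and for which $[u]^0:=\overline{\{x: u(x)>0\}}$ is compact; put $[u]^\alpha:=\{x: u(x)\ge\alpha\}$ for $\alpha\in(0,1]$. For a continuous pseudometric $d$ on $X$ and $u,v\in\mathcal K_{\mathcal F}(X)$ put $d_{HF}(u,v):=\sup_{\alpha\in[0,1]}d_H([u]^\alpha,[v]^\alpha)$,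 where $d_H(K,L)=\max\{\max_{x\in K}\min_{y\in L}d(x,y),\ \max_{y\in L}\min_{x\in K}d(x,y)\}$ for nonempty compact $K,L\subset X$; for an admissible $\mathcal D$ let $\mathcal D_{HF}:=\{d_{HF}:d\in\mathcal D\}$. *Fuzzy IFSs.* A fuzzy IFS $\mathcal S_{\mathcal F}=(\mathcal S,\rho)$ on $X$ consists of a finite system $\mathcal S=(f_i)_{i=1}^k$ of continuous maps $f_i:X\to X$ and a system $\rho=(\rho_i)_{i=1}^k$ of nondecreasing right-continuous maps $\rho_i:[0,1]\to[0,1]$ with $\rho_i(0)=0$ for all $i$ and $\rho_j(1)=1$ for some $j$. For Hausdorff $X$, its fuzzy Hutchinson operator $\mathcal S_{\mathcal F}:\mathcal K_{\mathcal F}(X)\to\mathcal K_{\mathcal F}(X)$ is $\mathcal S_{\mathcal F}(u):=\max_{1\le i\le k}\rho_i\circ f_i[u]$, where $f[u](y):=\sup\{u(x): f(x)=y\}$ and $\sup\emptyset:=0$. The system $\mathcal S$ is compactly dominating if every nonempty compact $K\subset X$ is contained in a compact $E\subset X$ with $\bigcup_i f_i(E)\subset E$. It is Edelstein contracting with respect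 to $\mathcal D$ if for all $d\in\mathcal D$, all $i$ and all $x,y\in X$ we have $d(f_i(x),f_i(y))\le d(x,y)$, with strict inequality whenever $d(x,y)>0$. **Theorem.** Let $X$ be a nonempty Tychonoff space and let $\mathcal S_{\mathcal F}=(\mathcal S,\rho)$ be a fuzzy IFS on $X$ such that $\mathcal S$ is compactly dominating and is Edelstein contracting with respect to some admissible multimetric on $X$. Then: 1. $X$ has a directed admissible multimetric, and the topology $\mathcal T_{\mathcal D_{HF}}$ on $\mathcal K_{\mathcal F}(X)$ is the same for all directed admissible multimetrics $\mathcal D$ on $X$. This topology is called the M-topology. 2. $\mathcal S_{\mathcal F}$ has a fuzzy attractor, and only one: there is a unique $u_{\mathcal S}\in\mathcal K_{\mathcal F}(X)$ such that $\mathcal S_{\mathcal F}(u_{\mathcal S})=u_{\mathcal S}$ and, for every $u\in\mathcal K_{\mathcal F}(X)$, the iterates $\mathcal S_{\mathcal F}^{(n)}(u)$ converge to $u_{\mathcal S}$ in the M-topology as $n\to\infty$. -/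

import Mathlib

open Set Filter
open scoped Topology unitInterval

noncomputable section

/-! ### Families of pseudometrics and the topologies they generate -/

/-- The topology generated by a family `d` of real functions of two variables on `Y` (in use:
pseudometrics). A set `U` is open iff every `x ∈ U` has `ε > 0` and a finite part `G` of the family
with `{y | ∀ i ∈ G, d i x y < ε} ⊆ U`. -/
@[reducible] def generatedTopology {ι Y : Type*} (d : ι → Y → Y → ℝ) : TopologicalSpace Y where
  IsOpen U := ∀ x ∈ U, ∃ ε : ℝ, 0 < ε ∧ ∃ G : Finset ι, {y | ∀ i ∈ G, d i x y < ε} ⊆ U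
  isOpen_univ := fun _ _ => ⟨1, one_pos, ∅, subset_univ _⟩
  isOpen_inter := by
    classical
    intro U V hU hV x hx
    obtain ⟨ε, hε, G, hG⟩ := hU x hx.1
    obtain ⟨δ, hδ, H, hH⟩ := hV x hx.2
    refine ⟨min ε δ, lt_min hε hδ, G ∪ H, fun y hy => ⟨hG fun i hi => ?_, hH fun i hi => ?_⟩⟩
    · exact (hy i (Finset.mem_union_left _ hi)).trans_le (min_le_left _ _)
    · exact (hy i (Finset.mem_union_right _ hi)).trans_le (min_le_right _ _)
  isOpen_sUnion := by
    intro s hs x hx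
    obtain ⟨U, hU, hxU⟩ := hx
    obtain ⟨ε, hε, G, hG⟩ := hs U hU x hxU
    exact ⟨ε, hε, G, hG.trans (subset_sUnion_of_mem hU)⟩

/-- A multimetric: a family of pseudometrics that separates points. -/
def IsMultimetric {X : Type*} (D : Set (PseudoMetric X ℝ)) : Prop :=
  ∀ x y : X, x ≠ y → ∃ d ∈ D, 0 < d x y

/-- A family of pseudometrics is directed if each nonempty finite subfamily is dominated pointwise
by a single member of the family. -/
def IsDirectedFamily {X : Type*} (D : Set (PseudoMetric X ℝ)) : Prop :=
  ∀ G : Finset (PseudoMetric X ℝ), G.Nonempty → (G : Set (PseudoMetric X ℝ)) ⊆ D →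
    ∃ d ∈ D, ∀ g ∈ G, ∀ x y : X, g x y ≤ d x y

/-- An admissible multimetric on a topological space: a multimetric generating its topology. -/
def IsAdmissibleMultimetric {X : Type*} [τ : TopologicalSpace X]
    (D : Set (PseudoMetric X ℝ)) : Prop :=
  IsMultimetric D ∧ generatedTopology (fun d : D => ⇑(d : PseudoMetric X ℝ)) = τ

/-- The Hausdorff distance with respect to a pseudometric. On nonempty compact sets and for a
continuous pseudometric all suprema and infima below are attained. -/
def pmHausdorffDist {X : Type*} (d : PseudoMetric X ℝ) (K L : Set X) : ℝ :=
  max (⨆ x : K, ⨅ y : L, d x y) (⨆ y : L, ⨅ x : K, d x y)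

/-! ### Compact fuzzy sets -/

/-- The `α`-cut of a fuzzy set: `{u ≥ α}` for `α > 0`, and the closure of `{u > 0}` for `α = 0`. -/
def fuzzyCut {X : Type*} [TopologicalSpace X] (u : X → I) (α : I) : Set X :=
  open Classical in if α = 0 then closure {x | 0 < u x} else {x | α ≤ u x}

/-- Compact fuzzy sets: normal, upper semicontinuous and compactly supported maps `X → [0,1]`. -/
@[ext]
structure CompactFuzzySet (X : Type*) [TopologicalSpace X] where
  toFun : X → I
  normal : ∃ x, toFun x = 1
  usc : UpperSemicontinuous toFun
  compactSupport : IsCompact (fuzzyCut toFun 0)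

/-- The fuzzy Hausdorff pseudometric: the supremum over `α ∈ [0,1]` of the Hausdorff distances of
the `α`-cuts. The supremum is finite whenever `d` is continuous. -/
def fuzzyHausdorffDist {X : Type*} [TopologicalSpace X] (d : PseudoMetric X ℝ)
    (u v : CompactFuzzySet X) : ℝ :=
  ⨆ α : I, pmHausdorffDist d (fuzzyCut u.toFun α) (fuzzyCut v.toFun α)

/-- The topology on compact fuzzy sets generated by the fuzzy Hausdorff pseudometrics of the
members of `D`. -/
@[reducible] def fuzzyTopology {X : Type*} [TopologicalSpace X] (D : Set (PseudoMetric X ℝ)) :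
    TopologicalSpace (CompactFuzzySet X) :=
  generatedTopology (fun d : D => fuzzyHausdorffDist (d : PseudoMetric X ℝ))

/-- `T` is the M-topology on the compact fuzzy sets of `X`: directed admissible multimetrics exist
on `X`, and every one of them generates `T`. -/
def IsMTopology {X : Type*} [TopologicalSpace X]
    (T : TopologicalSpace (CompactFuzzySet X)) : Prop :=
  (∃ D : Set (PseudoMetric X ℝ), IsAdmissibleMultimetric D ∧ IsDirectedFamily D) ∧
    ∀ D : Set (PseudoMetric X ℝ), IsAdmissibleMultimetric D → IsDirectedFamily D →
      fuzzyTopology D = T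

/-- The image `f[u]` of a fuzzy set: `y ↦ sup {u x | f x = y}` (equal to `0` on an empty fibre,
since the supremum is taken in `[0,1]`). -/
def fuzzyImage {X Y : Type*} (f : X → Y) (u : X → I) (y : Y) : I :=
  sSup (u '' (f ⁻¹' {y}))

/-! ### Fuzzy iterated function systems -/

/-- A fuzzy iterated function system: `k` continuous selfmaps together with an admissible system of
`k` grey level maps. -/
structure FuzzyIFS (X : Type*) [TopologicalSpace X] (k : ℕ) where
  map : Fin k → C(X, X)
  grey : Fin k → I → I
  grey_mono : ∀ i, Monotone (grey i)
  grey_rightCont : ∀ i t, ContinuousWithinAt (grey i) (Ici t) t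
  grey_zero : ∀ i, grey i 0 = 0
  grey_one : ∃ j, grey j 1 = 1

namespace FuzzyIFS

variable {X : Type*} [TopologicalSpace X] {k : ℕ}

/-- Each map of the system is an Edelstein contraction with respect to each pseudometric in `D`. -/
def EdelsteinContracting (S : FuzzyIFS X k) (D : Set (PseudoMetric X ℝ)) : Prop :=
  ∀ d ∈ D, ∀ i, (∀ x y, d (S.map i x) (S.map i y) ≤ d x y) ∧
    ∀ x y, 0 < d x y → d (S.map i x) (S.map i y) < d x y

/-- Each nonempty compact set lies in a nonempty compact set `E` with `⋃ i, f_i(E) ⊆ E`. -/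
def CompactlyDominating (S : FuzzyIFS X k) : Prop :=
  ∀ K : Set X, K.Nonempty → IsCompact K →
    ∃ E : Set X, E.Nonempty ∧ IsCompact E ∧ K ⊆ E ∧ (⋃ i, S.map i '' E) ⊆ E

/-- The fuzzy Hutchinson operator `u ↦ max_i ρ_i ∘ f_i[u]` on arbitrary fuzzy sets. -/
def hutchinsonFun (S : FuzzyIFS X k) (u : X → I) (x : X) : I :=
  Finset.univ.sup fun i => S.grey i (fuzzyImage (S.map i) u x)

end FuzzyIFS

/-! ### The fuzzy Hutchinson operator preserves compact fuzzy sets -/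

theorem CompactFuzzySet.image_cut {X : Type*} [TopologicalSpace X] [T2Space X] (f : C(X, X))
    (u : CompactFuzzySet X) {α : I} (hα : 0 < α) :
    {y | α ≤ fuzzyImage f u.toFun y} = f '' {x | α ≤ u.toFun x} := by
  ext y
  constructor
  · intro hy
    have hsup : ∀ x, 0 < u.toFun x → x ∈ fuzzyCut u.toFun 0 := by
      intro x hx
      simp only [fuzzyCut, if_true]
      exact subset_closure hx
    have hc : IsCompact (fuzzyCut u.toFun 0 ∩ f ⁻¹' {y}) :=
      u.compactSupport.inter_right (isClosed_singleton.preimage f.continuous)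
    have hne : (fuzzyCut u.toFun 0 ∩ f ⁻¹' {y}).Nonempty := by
      by_contra hemp
      have h0 : fuzzyImage f u.toFun y ≤ 0 := by
        refine sSup_le ?_
        rintro _ ⟨x, hx, rfl⟩
        by_contra hlt
        exact hemp ⟨x, hsup x (not_le.1 hlt), hx⟩
      exact absurd (lt_of_lt_of_le hα (le_trans hy h0)) (lt_irrefl _)
    obtain ⟨a, ha, hmax⟩ := (u.usc.upperSemicontinuousOn _).exists_isMaxOn hne hc
    refine ⟨a, show α ≤ u.toFun a from le_trans hy (sSup_le ?_), ha.2⟩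
    rintro _ ⟨x, hx, rfl⟩
    by_cases h : 0 < u.toFun x
    · exact hmax ⟨hsup x h, hx⟩
    · exact (not_lt.1 h).trans bot_le
  · rintro ⟨x, hx, rfl⟩
    exact le_trans (show α ≤ u.toFun x from hx) (le_sSup ⟨x, rfl, rfl⟩)

theorem CompactFuzzySet.image_usc {X : Type*} [TopologicalSpace X] [T2Space X] (f : C(X, X))
    (u : CompactFuzzySet X) : UpperSemicontinuous (fuzzyImage f u.toFun) := by
  rw [upperSemicontinuous_iff_isClosed_preimage]
  intro α
  rcases eq_or_lt_of_le (bot_le : (0 : I) ≤ α) with h | h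
  · convert isClosed_univ
    ext y
    simp only [mem_preimage, mem_Ici, mem_univ, iff_true]
    rw [← h]
    exact bot_le
  · have hc : IsCompact {x | α ≤ u.toFun x} := by
      refine u.compactSupport.of_isClosed_subset (u.usc.isClosed_preimage α) ?_
      intro x hx
      simp only [fuzzyCut, if_true]
      exact subset_closure (lt_of_lt_of_le h hx)
    have := (hc.image f.continuous).isClosed
    rw [← u.image_cut f h] at this
    exact this

theorem usc_grey_comp {X : Type*} [TopologicalSpace X] {g : X → I} (hg : UpperSemicontinuous g)
    {ρ : I → I} (hm : Monotone ρ) (hc : ∀ t, ContinuousWithinAt ρ (Ici t) t) :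
    UpperSemicontinuous fun x => ρ (g x) := by
  intro x y hxy
  by_cases h1 : g x = ⊤
  · refine Eventually.of_forall fun z => lt_of_le_of_lt (hm ?_) hxy
    rw [h1]
    exact le_top
  · have hlt : g x < ⊤ := lt_top_iff_ne_top.2 h1
    have hev : ∀ᶠ t in 𝓝[>] (g x), ρ t < y :=
      ((hc (g x)).mono Ioi_subset_Ici_self).eventually (eventually_lt_nhds hxy)
    have : (𝓝[>] (g x)).NeBot := nhdsGT_neBot_of_exists_gt ⟨⊤, hlt⟩
    obtain ⟨t, ht, htx⟩ := (hev.and self_mem_nhdsWithin).exists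
    filter_upwards [hg x t htx] with z hz
    exact lt_of_le_of_lt (hm hz.le) ht

namespace FuzzyIFS

variable {X : Type*} [TopologicalSpace X] {k : ℕ}

/-- The fuzzy Hutchinson operator on compact fuzzy sets. -/
def hutchinson [T2Space X] (S : FuzzyIFS X k) (u : CompactFuzzySet X) : CompactFuzzySet X where
  toFun := S.hutchinsonFun u.toFun
  normal := by
    obtain ⟨x, hx⟩ := u.normal
    obtain ⟨j, hj⟩ := S.grey_one
    refine ⟨S.map j x, le_antisymm le_top ?_⟩
    have h1 : fuzzyImage (S.map j) u.toFun (S.map j x) = 1 :=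
      le_antisymm le_top (hx ▸ le_sSup ⟨x, rfl, rfl⟩)
    have h2 := Finset.le_sup (f := fun i => S.grey i (fuzzyImage (S.map i) u.toFun (S.map j x)))
      (Finset.mem_univ j)
    simp only [h1, hj] at h2
    exact h2
  usc := by
    have key : ∀ s : Finset (Fin k), UpperSemicontinuous fun x =>
        s.sup fun i => S.grey i (fuzzyImage (S.map i) u.toFun x) := by
      classical
      intro s
      induction s using Finset.induction_on with
      | empty => simpa using upperSemicontinuous_const
      | insert i s _ ih =>
        simp only [Finset.sup_insert]
        exact (usc_grey_comp (u.image_usc (S.map i)) (S.grey_mono i) (S.grey_rightCont i)).sup ih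
    exact key Finset.univ
  compactSupport := by
    have hc : IsCompact (⋃ i, S.map i '' fuzzyCut u.toFun 0) :=
      isCompact_iUnion fun i => u.compactSupport.image (S.map i).continuous
    have hsub : {x | 0 < S.hutchinsonFun u.toFun x} ⊆ ⋃ i, S.map i '' fuzzyCut u.toFun 0 := by
      intro y hy
      obtain ⟨i, -, hi⟩ := (Finset.lt_sup_iff).1 (show (0 : I) < _ from hy)
      have hpos : 0 < fuzzyImage (S.map i) u.toFun y := by
        by_contra h
        rw [le_antisymm (not_lt.1 h) bot_le, S.grey_zero] at hi
        exact lt_irrefl _ hi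
      obtain ⟨_, ⟨x, hx, rfl⟩, hux⟩ := lt_sSup_iff.1 hpos
      refine mem_iUnion.2 ⟨i, x, ?_, hx⟩
      simp only [fuzzyCut, if_true]
      exact subset_closure hux
    simp only [fuzzyCut, if_true]
    exact hc.of_isClosed_subset isClosed_closure (closure_minimal hsub hc.isClosed)

/-- `u` is a fuzzy attractor with respect to the topology `T` on compact fuzzy sets: `u` is a fixed
point of the fuzzy Hutchinson operator, and the iterates at every compact fuzzy set converge to `u`
in `T`. -/
def IsFuzzyAttractor [T2Space X] (S : FuzzyIFS X k) (T : TopologicalSpace (CompactFuzzySet X))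
    (u : CompactFuzzySet X) : Prop :=
  S.hutchinson u = u ∧
    ∀ v : CompactFuzzySet X, Tendsto (fun n : ℕ => S.hutchinson^[n] v) atTop (@nhds _ T u)

end FuzzyIFS

end

/-! The relation `Within`, taken in both directions, replaces the Hausdorff distances of all cuts:
each point of positive grade has a nearby point of at least the same grade in the other set. For
continuous pseudometrics, compactness of the cuts makes this equivalent to a bound on
`fuzzyHausdorffDist`.

The topology does not depend on the multimetric because near a compact set a continuous pseudometric
is controlled by finitely many members of an admissible family, hence by one if the family is
directed (`fuzzyTopology_le`). All continuous pseudometrics for which the system is Edelstein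
contracting form such a family: it contains the given one and is closed under maxima.

A fixed point arises from below the characteristic function of an invariant compact set: its
iterates decrease, and compactness with right-continuity of the grey maps makes their infimum fixed
(`hutchinson_iInf_of_succ`). Convergence holds because strict contraction on a compact set leaves a
uniform gap near each positive distance, so no positive distance between two orbits can be a limit
(`eventually_within`). Two fixed points are thus arbitrarily close for each pseudometric, and upper
semicontinuity forces equality. -/

/-! ### Admissible families of pseudometrics -/

/-- A pseudometric is continuous if it is jointly continuous on `X × X`. -/
def PseudoMetric.IsContinuous {X : Type*} [TopologicalSpace X] (d : PseudoMetric X ℝ) : Prop :=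
  Continuous fun p : X × X => d p.1 p.2

theorem generatedTopology_le {ι κ Y : Type*} {d : ι → Y → Y → ℝ} {e : κ → Y → Y → ℝ}
    (h : ∀ y i, ∀ ε : ℝ, 0 < ε → ∃ δ : ℝ, 0 < δ ∧ ∃ G : Finset κ,
      ∀ z, (∀ j ∈ G, e j y z < δ) → d i y z < ε) :
    generatedTopology e ≤ generatedTopology d := by
  classical
  intro U hU y hy
  obtain ⟨ε, hε, F, hF⟩ := hU y hy
  suffices H : ∃ δ : ℝ, 0 < δ ∧ ∃ G : Finset κ,
      ∀ z, (∀ j ∈ G, e j y z < δ) → ∀ i ∈ F, d i y z < ε by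
    obtain ⟨δ, hδ, G, hG⟩ := H
    exact ⟨δ, hδ, G, fun z hz => hF (hG z hz)⟩
  clear hF
  induction F using Finset.induction_on with
  | empty => exact ⟨1, one_pos, ∅, by simp⟩
  | insert i F _ ih =>
    obtain ⟨δ, hδ, G, hG⟩ := ih
    obtain ⟨δ', hδ', G', hG'⟩ := h y i ε hε
    refine ⟨min δ δ', lt_min hδ hδ', G ∪ G', fun z hz => ?_⟩
    rw [Finset.forall_mem_insert]
    exact ⟨hG' z fun j hj => (hz j (Finset.mem_union_right _ hj)).trans_le (min_le_right _ _),
      hG z fun j hj => (hz j (Finset.mem_union_left _ hj)).trans_le (min_le_left _ _)⟩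

theorem tendsto_generatedTopology {ι Y : Type*} {d : ι → Y → Y → ℝ} {y : Y} {s : ℕ → Y}
    (h : ∀ i, ∀ ε : ℝ, 0 < ε → ∀ᶠ n in atTop, d i y (s n) < ε) :
    Tendsto s atTop (@nhds _ (generatedTopology d) y) := by
  let _ := generatedTopology d
  rw [tendsto_nhds]
  intro U hU hy
  obtain ⟨ε, hε, G, hG⟩ := hU y hy
  have : ∀ᶠ n in atTop, ∀ i ∈ G, d i y (s n) < ε :=
    (eventually_all_finset G).2 fun i _ => h i ε hε
  filter_upwards [this] with n hn using hG hn

theorem IsDirectedFamily.of_sup_mem {X : Type*} {D : Set (PseudoMetric X ℝ)}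
    (h : ∀ d ∈ D, ∀ e ∈ D, d ⊔ e ∈ D) : IsDirectedFamily D := by
  intro G hG hGD
  exact ⟨G.sup' hG id, Finset.sup'_mem D h G hG id fun i hi => hGD hi,
    fun g hg => Finset.le_sup' id hg⟩

/-- Finitely many members of a directed family are dominated by one, up to the degenerate case of
an empty collection. -/
theorem IsDirectedFamily.exists_le {X : Type*} {D : Set (PseudoMetric X ℝ)}
    (hD : IsDirectedFamily D) (G : Finset D) :
    G = ∅ ∨ ∃ d ∈ D, ∀ g ∈ G, ∀ x y, (g : PseudoMetric X ℝ) x y ≤ d x y := by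
  rcases G.eq_empty_or_nonempty with h | h
  · exact Or.inl h
  · obtain ⟨d, hd, hle⟩ := hD (G.map (Function.Embedding.subtype _)) (h.map) (by
      intro g hg
      simp only [Finset.coe_map, mem_image] at hg
      obtain ⟨g, -, rfl⟩ := hg
      exact g.2)
    exact Or.inr ⟨d, hd, fun g hg => hle g (Finset.mem_map_of_mem _ hg)⟩

theorem PseudoMetric.bddBelow_range {X : Type*} (d : PseudoMetric X ℝ) (x : X) (L : Set X) :
    BddBelow (range fun y : L => d x y) :=
  ⟨0, forall_mem_range.2 fun _ => d.nonneg _ _⟩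

section Admissible

variable {X : Type*} [TopologicalSpace X] {D : Set (PseudoMetric X ℝ)}

theorem PseudoMetric.IsContinuous.right {d : PseudoMetric X ℝ} (hd : d.IsContinuous) (x : X) :
    Continuous (d x) :=
  hd.comp (Continuous.prodMk_right x)

theorem PseudoMetric.isContinuous_of_ball_mem_nhds {d : PseudoMetric X ℝ}
    (h : ∀ x, ∀ ε : ℝ, 0 < ε → {y | d x y < ε} ∈ 𝓝 x) : d.IsContinuous := by
  refine continuous_iff_continuousAt.2 fun ⟨x, y⟩ => Metric.tendsto_nhds.2 fun ε hε => ?_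
  filter_upwards [prod_mem_nhds (h x (ε / 2) (half_pos hε)) (h y (ε / 2) (half_pos hε))]
  rintro ⟨a, b⟩ ⟨ha, hb⟩
  simp only [mem_ofPred_eq] at ha hb
  have h1 := d.triangle a x b
  have h2 := d.triangle x y b
  have h3 := d.triangle x a y
  have h4 := d.triangle a b y
  have h5 := d.symm a x
  have h6 := d.symm b y
  rw [Real.dist_eq, abs_lt]
  constructor <;> dsimp only <;> linarith

theorem IsAdmissibleMultimetric.isContinuous (hD : IsAdmissibleMultimetric D)
    {d : PseudoMetric X ℝ} (hd : d ∈ D) : d.IsContinuous := by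
  refine PseudoMetric.isContinuous_of_ball_mem_nhds fun x ε hε => IsOpen.mem_nhds ?_ (by simpa)
  rw [← hD.2]
  intro y hy
  refine ⟨ε - d x y, sub_pos.2 hy, {⟨d, hd⟩}, fun z hz => ?_⟩
  have hz' : d y z < ε - d x y := by simpa using hz
  have := d.triangle x y z
  simp only [mem_ofPred_eq]
  linarith

theorem IsAdmissibleMultimetric.exists_ball_subset (hD : IsAdmissibleMultimetric D) {U : Set X}
    (hU : IsOpen U) {x : X} (hx : x ∈ U) :
    ∃ ε : ℝ, 0 < ε ∧ ∃ G : Finset D, ∀ y, (∀ g ∈ G, (g : PseudoMetric X ℝ) x y < ε) → y ∈ U := by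
  rw [← hD.2] at hU
  obtain ⟨ε, hε, G, hG⟩ := hU x hx
  exact ⟨ε, hε, G, fun y hy => hG hy⟩

/-- Extra pseudometrics can only refine the generated topology, and continuous ones have open balls
already. -/
theorem IsAdmissibleMultimetric.mono {D' : Set (PseudoMetric X ℝ)}
    (hD : IsAdmissibleMultimetric D) (hDD' : D ⊆ D') (hc : ∀ d ∈ D', d.IsContinuous) :
    IsAdmissibleMultimetric D' := by
  refine ⟨fun x y hxy => (hD.1 x y hxy).imp fun d hd => ⟨hDD' hd.1, hd.2⟩, le_antisymm ?_ ?_⟩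
  · refine le_of_le_of_eq (generatedTopology_le fun y i ε hε => ?_) hD.2
    exact ⟨ε, hε, {⟨i, hDD' i.2⟩}, fun z hz => by simpa using hz⟩
  · intro U hU
    refine isOpen_iff_mem_nhds.2 fun x hx => ?_
    obtain ⟨ε, hε, G, hG⟩ := hU x hx
    have : ∀ᶠ y in 𝓝 x, ∀ i ∈ G, (i : PseudoMetric X ℝ) x y < ε :=
      (eventually_all_finset G).2 fun i _ =>
        ((hc i i.2).right x).continuousAt.eventually_lt continuousAt_const (by simpa)
    exact mem_of_superset this hG

/-- A continuous pseudometric is controlled, uniformly near a compact set, by finitely many members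
of an admissible multimetric. -/
theorem IsAdmissibleMultimetric.exists_uniform_control (hD : IsAdmissibleMultimetric D)
    {d : PseudoMetric X ℝ} (hd : d.IsContinuous) {K : Set X} (hK : IsCompact K) {ε : ℝ}
    (hε : 0 < ε) :
    ∃ δ : ℝ, 0 < δ ∧ ∃ G : Finset D, ∀ x ∈ K, ∀ y,
      (∀ g ∈ G, (g : PseudoMetric X ℝ) x y < δ) → d x y < ε := by
  classical
  refine hK.induction_on (p := fun K => ∃ δ : ℝ, 0 < δ ∧ ∃ G : Finset D, ∀ x ∈ K, ∀ y,
    (∀ g ∈ G, (g : PseudoMetric X ℝ) x y < δ) → d x y < ε) ⟨1, one_pos, ∅, by simp⟩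
    (fun s t hst ht => ?_) (fun s t hs ht => ?_) fun x _ => ?_
  · obtain ⟨δ, hδ, G, hG⟩ := ht
    exact ⟨δ, hδ, G, fun x hx => hG x (hst hx)⟩
  · obtain ⟨δ, hδ, G, hG⟩ := hs
    obtain ⟨δ', hδ', G', hG'⟩ := ht
    refine ⟨min δ δ', lt_min hδ hδ', G ∪ G', fun x hx y h => hx.elim (fun hx => ?_) fun hx => ?_⟩
    · exact hG x hx y fun g hg =>
        (h g (Finset.mem_union_left _ hg)).trans_le (min_le_left _ _)
    · exact hG' x hx y fun g hg =>
        (h g (Finset.mem_union_right _ hg)).trans_le (min_le_right _ _)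
  · have hopen : IsOpen {y | d x y < ε / 2} := isOpen_lt (hd.right x) continuous_const
    obtain ⟨δ, hδ, G, hG⟩ := hD.exists_ball_subset hopen (x := x) (by simpa using hε)
    have hV : ∀ᶠ z in 𝓝 x, ∀ g ∈ G, (g : PseudoMetric X ℝ) x z < δ / 2 :=
      (eventually_all_finset G).2 fun g _ =>
        ((hD.isContinuous g.2).right x).continuousAt.eventually_lt continuousAt_const
          (by simpa using hδ)
    -- Half of `δ` is spent between `x` and `z`, half between `z` and `y`, so both `z` and `y` lie
    -- in the ball around `x`.
    refine ⟨_, mem_nhdsWithin_of_mem_nhds hV, δ / 2, half_pos hδ, G, fun z hz y hy => ?_⟩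
    have h1 : d x y < ε / 2 := hG y fun g hg => by
      have := (g : PseudoMetric X ℝ).triangle x z y
      have h1 := hz g hg
      have h2 := hy g hg
      linarith
    have h2 : d x z < ε / 2 := hG z fun g hg => (hz g hg).trans (half_lt_self hδ)
    have h3 := d.triangle z x y
    rw [d.symm z x] at h3
    linarith

end Admissible

/-! ### Closeness of compact fuzzy sets -/

namespace CompactFuzzySet

variable {X : Type*} [TopologicalSpace X]

/-- Every point of `u` is within distance `r` of a point of `v` of at least the same grade. -/
def Within (d : PseudoMetric X ℝ) (r : ℝ) (u v : CompactFuzzySet X) : Prop :=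
  ∀ x, 0 < u.toFun x → ∃ y, u.toFun x ≤ v.toFun y ∧ d x y ≤ r

theorem fuzzyCut_zero (u : CompactFuzzySet X) : fuzzyCut u.toFun 0 = closure {x | 0 < u.toFun x} :=
  if_pos rfl

theorem fuzzyCut_of_pos (u : CompactFuzzySet X) {α : I} (hα : 0 < α) :
    fuzzyCut u.toFun α = {x | α ≤ u.toFun x} :=
  if_neg hα.ne'

theorem mem_fuzzyCut_zero {u : CompactFuzzySet X} {x : X} (hx : 0 < u.toFun x) :
    x ∈ fuzzyCut u.toFun 0 :=
  u.fuzzyCut_zero ▸ subset_closure hx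

theorem fuzzyCut_subset (u : CompactFuzzySet X) (α : I) :
    fuzzyCut u.toFun α ⊆ fuzzyCut u.toFun 0 := by
  rcases eq_or_lt_of_le (unitInterval.nonneg' : 0 ≤ α) with h | h
  · rw [← h]
  · rw [u.fuzzyCut_of_pos h]
    exact fun x hx => mem_fuzzyCut_zero (lt_of_lt_of_le h hx)

theorem isCompact_fuzzyCut (u : CompactFuzzySet X) (α : I) : IsCompact (fuzzyCut u.toFun α) := by
  refine u.compactSupport.of_isClosed_subset ?_ (u.fuzzyCut_subset α)
  rcases eq_or_lt_of_le (unitInterval.nonneg' : 0 ≤ α) with h | h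
  · rw [← h, u.fuzzyCut_zero]
    exact isClosed_closure
  · rw [u.fuzzyCut_of_pos h]
    exact u.usc.isClosed_preimage α

theorem fuzzyCut_nonempty (u : CompactFuzzySet X) (α : I) : (fuzzyCut u.toFun α).Nonempty := by
  obtain ⟨x, hx⟩ := u.normal
  refine ⟨x, ?_⟩
  rcases eq_or_lt_of_le (unitInterval.nonneg' : 0 ≤ α) with h | h
  · rw [← h]
    exact mem_fuzzyCut_zero (hx ▸ zero_lt_one)
  · rw [u.fuzzyCut_of_pos h]
    exact le_top.trans hx.ge

theorem Within.iInf_le {d : PseudoMetric X ℝ} (hd : d.IsContinuous) {r : ℝ}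
    {u v : CompactFuzzySet X} (h : Within d r u v) (α : I) {x : X} (hx : x ∈ fuzzyCut u.toFun α) :
    ⨅ y : fuzzyCut v.toFun α, d x y ≤ r := by
  rcases eq_or_lt_of_le (unitInterval.nonneg' : 0 ≤ α) with h0 | h0
  · subst h0
    -- Points of the zero cut may have grade 0, where `Within` says nothing; they are approximated
    -- by points of positive grade.
    refine le_of_forall_pos_le_add fun ε hε => ?_
    rw [fuzzyCut_zero] at hx
    obtain ⟨z, hz, hz'⟩ := mem_closure_iff.1 hx {z | d x z < ε}
      (isOpen_lt (hd.right x) continuous_const) (by simpa)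
    obtain ⟨y, hy, hzy⟩ := h z hz'
    refine (ciInf_le (PseudoMetric.bddBelow_range d x _)
      ⟨y, mem_fuzzyCut_zero (lt_of_lt_of_le hz' hy)⟩).trans ?_
    have := d.triangle x z y
    have hz2 : d x z < ε := hz
    linarith
  · rw [fuzzyCut_of_pos _ h0] at hx
    obtain ⟨y, hy, hxy⟩ := h x (lt_of_lt_of_le h0 hx)
    refine (ciInf_le (PseudoMetric.bddBelow_range d x _) ⟨y, ?_⟩).trans hxy
    rw [fuzzyCut_of_pos _ h0]
    exact le_trans (show α ≤ u.toFun x from hx) hy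

theorem fuzzyHausdorffDist_le {d : PseudoMetric X ℝ} (hd : d.IsContinuous) {r : ℝ}
    {u v : CompactFuzzySet X} (h : Within d r u v) (h' : Within d r v u) :
    fuzzyHausdorffDist d u v ≤ r := by
  refine ciSup_le fun α => max_le ?_ ?_
  · have := (u.fuzzyCut_nonempty α).to_subtype
    exact ciSup_le fun x => h.iInf_le hd α x.2
  · have := (v.fuzzyCut_nonempty α).to_subtype
    refine ciSup_le fun y => ?_
    simpa only [d.symm _ (y : X)] using h'.iInf_le hd α y.2

theorem exists_dist_le {d : PseudoMetric X ℝ} (hd : d.IsContinuous) (u v : CompactFuzzySet X) :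
    ∃ C : ℝ, ∀ x ∈ fuzzyCut u.toFun 0, ∀ y ∈ fuzzyCut v.toFun 0, d x y ≤ C := by
  obtain ⟨C, hC⟩ := (u.compactSupport.prod v.compactSupport).bddAbove_image hd.continuousOn
  exact ⟨C, fun x hx y hy => hC ⟨(x, y), ⟨hx, hy⟩, rfl⟩⟩

theorem iInf_dist_le_fuzzyHausdorffDist {d : PseudoMetric X ℝ} (hd : d.IsContinuous)
    (u v : CompactFuzzySet X) (α : I) :
    (∀ x ∈ fuzzyCut u.toFun α, ⨅ y : fuzzyCut v.toFun α, d x y ≤ fuzzyHausdorffDist d u v) ∧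
    ∀ y ∈ fuzzyCut v.toFun α, ⨅ x : fuzzyCut u.toFun α, d x y ≤ fuzzyHausdorffDist d u v := by
  obtain ⟨C, hC⟩ := exists_dist_le hd u v
  have hu (β : I) (x : fuzzyCut u.toFun β) : ⨅ y : fuzzyCut v.toFun β, d x y ≤ C := by
    obtain ⟨y, hy⟩ := v.fuzzyCut_nonempty β
    exact (ciInf_le (PseudoMetric.bddBelow_range d x _) ⟨y, hy⟩).trans
      (hC x (u.fuzzyCut_subset β x.2) y (v.fuzzyCut_subset β hy))
  have hv (β : I) (y : fuzzyCut v.toFun β) : ⨅ x : fuzzyCut u.toFun β, d x y ≤ C := by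
    obtain ⟨x, hx⟩ := u.fuzzyCut_nonempty β
    refine (ciInf_le ⟨0, forall_mem_range.2 fun _ => d.nonneg _ _⟩ ⟨x, hx⟩).trans
      (hC x (u.fuzzyCut_subset β hx) y (v.fuzzyCut_subset β y.2))
  -- Boundedness is essential: the real supremum of an unbounded family is 0 by default.
  have hb : BddAbove (range fun β : I =>
      pmHausdorffDist d (fuzzyCut u.toFun β) (fuzzyCut v.toFun β)) := by
    refine ⟨C, forall_mem_range.2 fun β => max_le ?_ ?_⟩
    · have := (u.fuzzyCut_nonempty β).to_subtype
      exact ciSup_le (hu β)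
    · have := (v.fuzzyCut_nonempty β).to_subtype
      exact ciSup_le (hv β)
  constructor
  · intro x hx
    exact ((le_ciSup (f := fun x : fuzzyCut u.toFun α => ⨅ y : fuzzyCut v.toFun α, d x y)
      ⟨C, forall_mem_range.2 (hu α)⟩ ⟨x, hx⟩).trans (le_max_left _ _)).trans (le_ciSup hb α)
  · intro y hy
    exact ((le_ciSup (f := fun y : fuzzyCut v.toFun α => ⨅ x : fuzzyCut u.toFun α, d x y)
      ⟨C, forall_mem_range.2 (hv α)⟩ ⟨y, hy⟩).trans (le_max_right _ _)).trans (le_ciSup hb α)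

theorem exists_dist_eq_iInf {d : PseudoMetric X ℝ} (hd : d.IsContinuous) {K : Set X}
    (hK : IsCompact K) (hne : K.Nonempty) (x : X) : ∃ y ∈ K, d x y = ⨅ y : K, d x y := by
  obtain ⟨y, hy, hmin⟩ := hK.exists_isMinOn hne (hd.right x).continuousOn
  have := hne.to_subtype
  exact ⟨y, hy, le_antisymm (le_ciInf fun z => hmin z.2)
    (ciInf_le (PseudoMetric.bddBelow_range d x K) ⟨y, hy⟩)⟩

/-- For a point of positive grade, the cut of the other set at exactly that grade is compact, so a
nearest point in it exists and has a sufficient grade. -/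
theorem within_fuzzyHausdorffDist {d : PseudoMetric X ℝ} (hd : d.IsContinuous)
    (u v : CompactFuzzySet X) :
    Within d (fuzzyHausdorffDist d u v) u v ∧ Within d (fuzzyHausdorffDist d u v) v u := by
  constructor
  · intro x hx
    obtain ⟨y, hy, hxy⟩ := exists_dist_eq_iInf hd (v.isCompact_fuzzyCut (u.toFun x))
      (v.fuzzyCut_nonempty _) x
    refine ⟨y, by rwa [v.fuzzyCut_of_pos hx] at hy, hxy.trans_le ?_⟩
    refine (iInf_dist_le_fuzzyHausdorffDist hd u v (u.toFun x)).1 x ?_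
    rw [u.fuzzyCut_of_pos hx]
    exact le_refl (u.toFun x)
  · intro y hy
    obtain ⟨x, hx, hyx⟩ := exists_dist_eq_iInf hd (u.isCompact_fuzzyCut (v.toFun y))
      (u.fuzzyCut_nonempty _) y
    refine ⟨x, by rwa [u.fuzzyCut_of_pos hy] at hx, hyx.trans_le ?_⟩
    simp only [d.symm y]
    refine (iInf_dist_le_fuzzyHausdorffDist hd u v (v.toFun y)).2 y ?_
    rw [v.fuzzyCut_of_pos hy]
    exact le_refl (v.toFun y)

theorem Within.mono {d : PseudoMetric X ℝ} {r s : ℝ} {u v : CompactFuzzySet X}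
    (h : Within d r u v) (hrs : r ≤ s) : Within d s u v :=
  fun x hx => (h x hx).imp fun _ hy => ⟨hy.1, hy.2.trans hrs⟩

end CompactFuzzySet

open CompactFuzzySet

/-! ### Independence of the M-topology from the multimetric, and separation -/

section MTopology

variable {X : Type*} [TopologicalSpace X] {D D' : Set (PseudoMetric X ℝ)}

theorem fuzzyTopology_le (hD : IsAdmissibleMultimetric D) (hdir : IsDirectedFamily D)
    (hD' : ∀ d ∈ D', d.IsContinuous) : fuzzyTopology D ≤ fuzzyTopology D' := by
  refine generatedTopology_le fun u ⟨d, hd⟩ ε hε => ?_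
  have hdc := hD' d hd
  obtain ⟨δ, hδ, G, hG⟩ := hD.exists_uniform_control hdc u.compactSupport (half_pos hε)
  have key (v : CompactFuzzySet X) (h : ∀ x ∈ fuzzyCut u.toFun 0, 0 < u.toFun x →
      ∃ y, u.toFun x ≤ v.toFun y ∧ ∀ g ∈ G, (g : PseudoMetric X ℝ) x y < δ)
      (h' : ∀ y, 0 < v.toFun y →
        ∃ x, v.toFun y ≤ u.toFun x ∧ ∀ g ∈ G, (g : PseudoMetric X ℝ) x y < δ) :
      fuzzyHausdorffDist d u v < ε := by
    refine (fuzzyHausdorffDist_le hdc (fun x hx => ?_) fun y hy => ?_).trans_lt (half_lt_self hε)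
    · obtain ⟨y, hy, hg⟩ := h x (mem_fuzzyCut_zero hx) hx
      exact ⟨y, hy, (hG x (mem_fuzzyCut_zero hx) y hg).le⟩
    · obtain ⟨x, hx, hg⟩ := h' y hy
      exact ⟨x, hx, (d.symm y x).trans_le
        (hG x (mem_fuzzyCut_zero (lt_of_lt_of_le hy hx)) y hg).le⟩
  -- Directedness lets one partner point be close for all of `G` at once. If `G` is empty, closeness
  -- is no condition and a point of grade 1 serves as partner.
  rcases hdir.exists_le G with rfl | ⟨e, he, hle⟩
  · refine ⟨1, one_pos, ∅, fun v _ => key v (fun x _ _ => ?_) fun y _ => ?_⟩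
    · obtain ⟨y, hy⟩ := v.normal
      exact ⟨y, le_top.trans hy.ge, by simp⟩
    · obtain ⟨x, hx⟩ := u.normal
      exact ⟨x, le_top.trans hx.ge, by simp⟩
  · refine ⟨δ, hδ, {⟨e, he⟩}, fun v hv => ?_⟩
    have hv' : fuzzyHausdorffDist e u v < δ := by simpa using hv
    obtain ⟨h1, h2⟩ := within_fuzzyHausdorffDist (hD.isContinuous he) u v
    refine key v (fun x _ hx => ?_) fun y hy => ?_
    · obtain ⟨y, hxy, hd⟩ := h1 x hx
      exact ⟨y, hxy, fun g hg => (hle g hg x y).trans_lt (hd.trans_lt hv')⟩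
    · obtain ⟨x, hxy, hd⟩ := h2 y hy
      exact ⟨x, hxy, fun g hg => (hle g hg x y).trans_lt ((e.symm x y).trans_lt (hd.trans_lt hv'))⟩

theorem isMTopology_fuzzyTopology (hD : IsAdmissibleMultimetric D) (hdir : IsDirectedFamily D) :
    IsMTopology (fuzzyTopology D) :=
  ⟨⟨D, hD, hdir⟩, fun _ hD' hdir' => le_antisymm
    (fuzzyTopology_le hD' hdir' fun _ => hD.isContinuous)
    (fuzzyTopology_le hD hdir fun _ => hD'.isContinuous)⟩

/-- If `v x < u x`, upper semicontinuity keeps `v` below `u x` on a ball around `x`, while `Within`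
puts a point of grade at least `u x` in that ball. -/
theorem CompactFuzzySet.toFun_le_of_within (hD : IsAdmissibleMultimetric D)
    (hdir : IsDirectedFamily D) {u v : CompactFuzzySet X}
    (h : ∀ d ∈ D, ∀ r : ℝ, 0 < r → Within d r u v) : u.toFun ≤ v.toFun := by
  intro x
  by_contra! hlt
  have hopen : IsOpen {y | v.toFun y < u.toFun x} := v.usc.isOpen_preimage _
  obtain ⟨ε, hε, G, hG⟩ := hD.exists_ball_subset hopen hlt
  rcases hdir.exists_le G with rfl | ⟨d, hd, hle⟩
  · obtain ⟨y, hy⟩ := v.normal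
    have : v.toFun y < u.toFun x := hG y (by simp)
    exact absurd (this.trans_le le_top) (by rw [hy]; exact lt_irrefl _)
  · obtain ⟨y, hy, hxy⟩ := h d hd (ε / 2) (half_pos hε) x (bot_le.trans_lt hlt)
    exact (hG y fun g hg => ((hle g hg x y).trans hxy).trans_lt (half_lt_self hε)).not_ge hy

end MTopology

/-! ### The fuzzy Hutchinson operator -/

theorem fuzzyImage_mono {X Y : Type*} (f : X → Y) {u v : X → I} (h : u ≤ v) :
    fuzzyImage f u ≤ fuzzyImage f v := by
  refine fun y => sSup_le ?_
  rintro _ ⟨x, hx, rfl⟩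
  exact (h x).trans (le_sSup ⟨x, hx, rfl⟩)

theorem le_fuzzyImage {X Y : Type*} (f : X → Y) (u : X → I) (x : X) : u x ≤ fuzzyImage f u (f x) :=
  le_sSup ⟨x, rfl, rfl⟩

/-! ### A fixed point as the infimum of decreasing iterates -/

/-- The characteristic function of a nonempty compact set, as a compact fuzzy set. -/
noncomputable def CompactFuzzySet.ofCompact {X : Type*} [TopologicalSpace X] [T2Space X] (E : Set X)
    (hne : E.Nonempty) (hE : IsCompact E) : CompactFuzzySet X where
  toFun := E.indicator 1
  normal := hne.imp fun x hx => by simp [hx]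
  usc := hE.isClosed.upperSemicontinuous_indicator zero_le_one
  compactSupport := by
    have : {x | 0 < E.indicator (1 : X → I) x} ⊆ E := fun x hx => by
      by_contra h
      simp [h] at hx
    rw [fuzzyCut, if_pos rfl]
    exact hE.of_isClosed_subset isClosed_closure (closure_minimal this hE.isClosed)

/-- The infimum of a decreasing sequence of compact fuzzy sets. -/
noncomputable def CompactFuzzySet.iInf {X : Type*} [TopologicalSpace X] (s : ℕ → CompactFuzzySet X)
    (hs : Antitone fun n => (s n).toFun) : CompactFuzzySet X where
  toFun x := ⨅ n, (s n).toFun x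
  normal := by
    obtain ⟨x, hx⟩ := IsCompact.nonempty_iInter_of_sequence_nonempty_isCompact_isClosed
      (fun n => {x | 1 ≤ (s n).toFun x}) (fun n x hx => le_trans hx (hs n.le_succ x))
      (fun n => (s n).normal.imp fun x hx => hx.ge)
      ((s 0).fuzzyCut_of_pos one_pos ▸ (s 0).isCompact_fuzzyCut 1)
      (fun n => (s n).usc.isClosed_preimage 1)
    exact ⟨x, le_antisymm le_top (le_iInf fun n => mem_iInter.1 hx n)⟩
  usc := upperSemicontinuous_iInf fun n => (s n).usc
  compactSupport := by
    refine (s 0).compactSupport.of_isClosed_subset ?_ ?_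
    · rw [fuzzyCut, if_pos rfl]
      exact isClosed_closure
    · rw [fuzzyCut, if_pos rfl, fuzzyCut_zero]
      exact closure_mono fun x (hx : 0 < ⨅ n, (s n).toFun x) =>
        show 0 < (s 0).toFun x from hx.trans_le (iInf_le _ 0)

/-- Pigeonhole: if every index failed at some stage, all would fail at the largest of these stages.
It fixes one map of the system for all iterates. -/
theorem exists_forall_of_antitone {ι : Type*} [Finite ι] {p : ι → ℕ → Prop}
    (hp : ∀ i m n, m ≤ n → p i n → p i m) (h : ∀ n, ∃ i, p i n) : ∃ i, ∀ n, p i n := by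
  have := Fintype.ofFinite ι
  by_contra! hcon
  choose N hN using hcon
  obtain ⟨i, hi⟩ := h (Finset.univ.sup N)
  exact hN i (hp i _ _ (Finset.le_sup (Finset.mem_univ i)) hi)

namespace FuzzyIFS

variable {X : Type*} [TopologicalSpace X] {k : ℕ}

theorem le_hutchinsonFun (S : FuzzyIFS X k) (u : X → I) (i : Fin k) (x : X) :
    S.grey i (u x) ≤ S.hutchinsonFun u (S.map i x) :=
  (S.grey_mono i (le_fuzzyImage _ u x)).trans
    (Finset.le_sup (f := fun j => S.grey j (fuzzyImage (S.map j) u (S.map i x)))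
      (Finset.mem_univ i))

theorem hutchinsonFun_mono (S : FuzzyIFS X k) {u v : X → I} (h : u ≤ v) :
    S.hutchinsonFun u ≤ S.hutchinsonFun v :=
  fun y => Finset.sup_mono_fun fun i _ => S.grey_mono i (fuzzyImage_mono _ h y)

/-- Both the finite maximum and the supremum over the fibre are attained; `grey_zero` ensures that
the fibre supremum is positive, as `image_cut` requires. -/
theorem exists_of_hutchinsonFun_pos [T2Space X] (S : FuzzyIFS X k) (u : CompactFuzzySet X) {y : X}
    (hy : 0 < S.hutchinsonFun u.toFun y) :
    ∃ i x, S.map i x = y ∧ 0 < u.toFun x ∧ S.hutchinsonFun u.toFun y = S.grey i (u.toFun x) := by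
  obtain ⟨i, -, hi⟩ := Finset.lt_sup_iff.1 hy
  have hne : (Finset.univ : Finset (Fin k)).Nonempty := ⟨i, Finset.mem_univ i⟩
  obtain ⟨i, -, hi⟩ := Finset.exists_mem_eq_sup _ hne
    fun i => S.grey i (fuzzyImage (S.map i) u.toFun y)
  have hi : S.hutchinsonFun u.toFun y = S.grey i (fuzzyImage (S.map i) u.toFun y) := hi
  have hpos : 0 < fuzzyImage (S.map i) u.toFun y := by
    refine unitInterval.pos_iff_ne_zero.2 fun h => ?_
    rw [hi, h, S.grey_zero] at hy
    exact lt_irrefl _ hy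
  obtain ⟨x, hx, rfl⟩ := (u.image_cut (S.map i) hpos).subset (le_refl (fuzzyImage _ _ y))
  have hxe := le_antisymm hx (le_fuzzyImage (S.map i) u.toFun x)
  rw [hxe] at hpos hi
  exact ⟨i, x, rfl, hpos, hi⟩

/-- A decreasing sequence approaches its infimum from the right, so right-continuity suffices. -/
theorem le_grey_iInf (S : FuzzyIFS X k) (i : Fin k) {t : ℕ → I} (ht : Antitone t) {α : I}
    (h : ∀ n, α ≤ S.grey i (t n)) : α ≤ S.grey i (⨅ n, t n) :=
  ge_of_tendsto' ((S.grey_rightCont i _).tendsto.comp (tendsto_nhdsWithin_iff.2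
    ⟨tendsto_atTop_iInf ht, Eventually.of_forall fun n => iInf_le t n⟩)) h

theorem hutchinson_iInf_of_succ [T2Space X] (S : FuzzyIFS X k) (s : ℕ → CompactFuzzySet X)
    (hs : Antitone fun n => (s n).toFun) (hsucc : ∀ n, S.hutchinson (s n) = s (n + 1)) :
    S.hutchinson (CompactFuzzySet.iInf s hs) = CompactFuzzySet.iInf s hs := by
  have hle (n : ℕ) : S.hutchinsonFun (CompactFuzzySet.iInf s hs).toFun ≤ (s (n + 1)).toFun := by
    rw [← hsucc n]
    exact S.hutchinsonFun_mono fun x => iInf_le _ n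
  refine CompactFuzzySet.ext (le_antisymm (fun y => ?_) fun y => ?_)
  · exact le_iInf fun n => (hle n y).trans (hs n.le_succ y)
  · rcases eq_or_lt_of_le (unitInterval.nonneg' (t := (CompactFuzzySet.iInf s hs).toFun y))
      with h | hpos
    · exact h.symm.trans_le unitInterval.nonneg'
    set α := (CompactFuzzySet.iInf s hs).toFun y
    have hα (n : ℕ) : α ≤ (s n).toFun y := iInf_le (fun n => (s n).toFun y) n
    have hmono (i : Fin k) (x : X) (m n : ℕ) (hmn : m ≤ n)
        (h : α ≤ S.grey i ((s n).toFun x)) : α ≤ S.grey i ((s m).toFun x) :=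
      h.trans (S.grey_mono i (hs hmn x))
    obtain ⟨i, hi⟩ : ∃ i, ∀ n, ∃ x ∈ fuzzyCut (s 0).toFun 0,
        S.map i x = y ∧ α ≤ S.grey i ((s n).toFun x) := by
      refine exists_forall_of_antitone (fun i m n hmn => ?_) fun n => ?_
      · rintro ⟨x, hx, hxy, h⟩
        exact ⟨x, hx, hxy, hmono i x m n hmn h⟩
      · have hn : α ≤ S.hutchinsonFun (s n).toFun y := by
          have := hα (n + 1)
          rwa [← hsucc n] at this
        obtain ⟨i, x, hxy, hx, he⟩ := S.exists_of_hutchinsonFun_pos (s n) (hpos.trans_le hn)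
        exact ⟨i, x, mem_fuzzyCut_zero (hx.trans_le (hs n.zero_le x)), hxy, he ▸ hn⟩
    have hcl (n : ℕ) : IsClosed (S.map i ⁻¹' {y} ∩ {x | α ≤ S.grey i ((s n).toFun x)}) :=
      (isClosed_singleton.preimage (S.map i).continuous).inter
        ((usc_grey_comp (s n).usc (S.grey_mono i) (S.grey_rightCont i)).isClosed_preimage α)
    -- Cantor's intersection theorem turns the preimages of `y` found at each stage into a single
    -- one valid at all stages.
    obtain ⟨x, hx⟩ := IsCompact.nonempty_iInter_of_sequence_nonempty_isCompact_isClosed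
      (fun n => fuzzyCut (s 0).toFun 0 ∩ (S.map i ⁻¹' {y} ∩ {x | α ≤ S.grey i ((s n).toFun x)}))
      (fun n x hx => ⟨hx.1, hx.2.1, hmono i x n (n + 1) n.le_succ hx.2.2⟩) hi
      ((s 0).compactSupport.inter_right (hcl 0))
      (fun n => ((s 0).fuzzyCut_zero ▸ isClosed_closure).inter (hcl n))
    rw [mem_iInter] at hx
    have hxy : S.map i x = y := (hx 0).2.1
    subst hxy
    exact (S.le_grey_iInf i (fun m n hmn => hs hmn x) fun n => (hx n).2.2).trans
      (S.le_hutchinsonFun (CompactFuzzySet.iInf s hs).toFun i x)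

theorem hutchinson_supported [T2Space X] (S : FuzzyIFS X k) {E : Set X}
    (hE : (⋃ i, S.map i '' E) ⊆ E) {u : CompactFuzzySet X} (hu : ∀ x, 0 < u.toFun x → x ∈ E) :
    ∀ x, 0 < (S.hutchinson u).toFun x → x ∈ E := by
  intro y hy
  obtain ⟨i, x, rfl, hx, -⟩ := S.exists_of_hutchinsonFun_pos u hy
  exact hE (mem_iUnion.2 ⟨i, x, hu x hx, rfl⟩)

theorem iterate_hutchinson_supported [T2Space X] (S : FuzzyIFS X k) {E : Set X}
    (hE : (⋃ i, S.map i '' E) ⊆ E) {u : CompactFuzzySet X} (hu : ∀ x, 0 < u.toFun x → x ∈ E)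
    (n : ℕ) : ∀ x, 0 < (S.hutchinson^[n] u).toFun x → x ∈ E := by
  induction n with
  | zero => exact hu
  | succ n ih =>
    rw [Function.iterate_succ_apply']
    exact S.hutchinson_supported hE ih

theorem exists_hutchinson_eq_self [T2Space X] (S : FuzzyIFS X k) {E : Set X} (hne : E.Nonempty)
    (hE : IsCompact E) (hinv : (⋃ i, S.map i '' E) ⊆ E) :
    ∃ u : CompactFuzzySet X, S.hutchinson u = u := by
  set s : ℕ → CompactFuzzySet X := fun n => S.hutchinson^[n] (ofCompact E hne hE)
  have hsucc (n : ℕ) : S.hutchinson (s n) = s (n + 1) :=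
    (Function.iterate_succ_apply' S.hutchinson n _).symm
  have h0 : ∀ x, 0 < (s 0).toFun x → x ∈ E := fun x hx => by
    by_contra h
    have : (s 0).toFun x = 0 := indicator_of_notMem h 1
    exact hx.ne' this
  have hanti : Antitone fun n => (s n).toFun := by
    refine antitone_nat_of_succ_le fun n => ?_
    induction n with
    | zero =>
      intro x
      rcases eq_or_lt_of_le (unitInterval.nonneg' (t := (s 1).toFun x)) with h | h
      · exact h.symm.trans_le unitInterval.nonneg'
      · have hx : x ∈ E := S.hutchinson_supported hinv h0 x (by rwa [hsucc 0])
        have : (s 0).toFun x = 1 := indicator_of_mem hx 1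
        exact le_top.trans this.ge
    | succ n ih =>
      -- Only the first comparison needs invariance of `E`; monotonicity of the operator propagates
      -- it.
      rw [← hsucc n, ← hsucc (n + 1)]
      exact S.hutchinsonFun_mono ih
  exact ⟨_, S.hutchinson_iInf_of_succ s hanti hsucc⟩

/-! ### Convergence of the iterates -/

/-- A point of positive grade in the image comes from some `x` under one map; applying the same map
to a partner of `x` gives its partner, as the grey map is monotone. -/
theorem within_hutchinson [T2Space X] (S : FuzzyIFS X k) {d : PseudoMetric X ℝ} {E : Set X}
    {r s : ℝ} (hrs : ∀ i, ∀ x ∈ E, ∀ y ∈ E, d x y ≤ r → d (S.map i x) (S.map i y) ≤ s)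
    {u v : CompactFuzzySet X} (hu : ∀ x, 0 < u.toFun x → x ∈ E) (hv : ∀ x, 0 < v.toFun x → x ∈ E)
    (h : Within d r u v) : Within d s (S.hutchinson u) (S.hutchinson v) := by
  intro y hy
  obtain ⟨i, x, rfl, hx, he⟩ := S.exists_of_hutchinsonFun_pos u hy
  obtain ⟨z, hz, hxz⟩ := h x hx
  refine ⟨S.map i z, ?_, hrs i x (hu x hx) z (hv z (hx.trans_le hz)) hxz⟩
  exact he.trans_le ((S.grey_mono i hz).trans (S.le_hutchinsonFun v.toFun i z))

/-- On a compact set, an Edelstein contracting system contracts distances near a given positive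
number by a definite amount. -/
theorem exists_contraction_gap (S : FuzzyIFS X k) {d : PseudoMetric X ℝ} (hd : d.IsContinuous)
    (hS : S.EdelsteinContracting {d}) {E : Set X} (hE : IsCompact E) {t : ℝ} (ht : 0 < t) :
    ∃ η : ℝ, 0 < η ∧ ∀ i, ∀ x ∈ E, ∀ y ∈ E, d x y < t + η →
      d (S.map i x) (S.map i y) ≤ t - η := by
  have hi (i : Fin k) : ∃ η : ℝ, 0 < η ∧ ∀ x ∈ E, ∀ y ∈ E, d x y < t + η →
      d (S.map i x) (S.map i y) ≤ t - η := by
    have hc : Continuous fun p : X × X =>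
        max (d p.1 p.2 - t) (t - d (S.map i p.1) (S.map i p.2)) := by
      refine (Continuous.sub hd continuous_const).max (continuous_const.sub ?_)
      exact Continuous.comp hd ((S.map i).continuous.prodMap (S.map i).continuous)
    -- Otherwise `d p.1 p.2 ≤ t` while the images are at distance at least `t > 0`, against strict
    -- contraction. The positive lower bound on `E × E` is the gap `η`.
    have hpos (p : X × X) : 0 < max (d p.1 p.2 - t) (t - d (S.map i p.1) (S.map i p.2)) := by
      by_contra! hle
      obtain ⟨h1, h2⟩ := max_le_iff.1 hle
      obtain ⟨h3, h4⟩ := hS d rfl i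
      have h5 := h3 p.1 p.2
      have h6 := h4 p.1 p.2 (by linarith)
      linarith
    obtain ⟨η, hη, hle⟩ := (hE.prod hE).exists_forall_le' hc.continuousOn (a := 0)
      fun p _ => hpos p
    refine ⟨η, hη, fun x hx y hy hxy => ?_⟩
    rcases le_max_iff.1 (hle (x, y) ⟨hx, hy⟩) with h | h <;> dsimp only at h <;> linarith
  choose η hη hle using hi
  rcases isEmpty_or_nonempty (Fin k) with _ | _
  · exact ⟨1, one_pos, fun i => isEmptyElim i⟩
  · obtain ⟨j, hj⟩ := Finite.exists_min η
    refine ⟨η j, hη j, fun i x hx y hy hxy => (hle i x hx y hy ?_).trans ?_⟩ <;>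
      linarith [hj i]

theorem eventually_within [T2Space X] (S : FuzzyIFS X k) {d : PseudoMetric X ℝ}
    (hd : d.IsContinuous) (hS : S.EdelsteinContracting {d}) {E : Set X} (hE : IsCompact E)
    (hinv : (⋃ i, S.map i '' E) ⊆ E) {u v : CompactFuzzySet X} (hu : ∀ x, 0 < u.toFun x → x ∈ E)
    (hv : ∀ x, 0 < v.toFun x → x ∈ E) {ε : ℝ} (hε : 0 < ε) :
    ∀ᶠ n in atTop, Within d ε (S.hutchinson^[n] u) (S.hutchinson^[n] v) := by
  have hstep {r s : ℝ} (hrs : ∀ i, ∀ x ∈ E, ∀ y ∈ E, d x y ≤ r → d (S.map i x) (S.map i y) ≤ s)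
      (n : ℕ) (h : Within d r (S.hutchinson^[n] u) (S.hutchinson^[n] v)) :
      Within d s (S.hutchinson^[n + 1] u) (S.hutchinson^[n + 1] v) := by
    rw [Function.iterate_succ_apply', Function.iterate_succ_apply']
    exact S.within_hutchinson hrs (S.iterate_hutchinson_supported hinv hu n)
      (S.iterate_hutchinson_supported hinv hv n) h
  -- If the infimum of these radii were positive, a radius just above it would drop below it after
  -- one more iteration, by the gap.
  set R : Set ℝ := {r | 0 ≤ r ∧ ∃ n, Within d r (S.hutchinson^[n] u) (S.hutchinson^[n] v)}
  have hRne : R.Nonempty := by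
    refine ⟨max (fuzzyHausdorffDist d u v) 0, le_max_right _ _, 0, ?_⟩
    exact (within_fuzzyHausdorffDist hd u v).1.mono (le_max_left _ _)
  have hRbdd : BddBelow R := ⟨0, fun r hr => hr.1⟩
  have hinf : sInf R < ε := by
    by_contra! hle
    obtain ⟨η, hη, hgap⟩ := S.exists_contraction_gap hd hS hE (hε.trans_le hle)
    obtain ⟨r, ⟨-, n, hn⟩, hr⟩ := exists_lt_of_csInf_lt hRne (lt_add_of_pos_right (sInf R) hη)
    -- The maximum with 0 ensures membership in `R`; it is still below `sInf R`, which is at least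
    -- `ε > 0`.
    have hmem : max (sInf R - η) 0 ∈ R := ⟨le_max_right _ _, n + 1,
      (hstep (fun i x hx y hy hxy => hgap i x hx y hy (hxy.trans_lt hr)) n hn).mono
        (le_max_left _ _)⟩
    have := csInf_le hRbdd hmem
    rcases le_max_iff.1 this with h | h <;> linarith
  obtain ⟨r, ⟨-, n, hn⟩, hr⟩ := exists_lt_of_csInf_lt hRne hinf
  -- Closeness, once reached, persists because the maps are nonexpansive.
  refine eventually_atTop.2 ⟨n, fun m hm => ?_⟩
  induction m, hm using Nat.le_induction with
  | base => exact hn.mono hr.le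
  | succ m _ ih =>
    exact hstep (fun i x _ y _ hxy => ((hS d rfl i).1 x y).trans hxy) m ih

theorem eventually_within_of_compactlyDominating [T2Space X] (S : FuzzyIFS X k)
    (hdom : S.CompactlyDominating) {d : PseudoMetric X ℝ} (hd : d.IsContinuous)
    (hS : S.EdelsteinContracting {d}) (u v : CompactFuzzySet X) {ε : ℝ} (hε : 0 < ε) :
    ∀ᶠ n in atTop, Within d ε (S.hutchinson^[n] u) (S.hutchinson^[n] v) := by
  obtain ⟨E, -, hE, hsub, hinv⟩ := hdom (fuzzyCut u.toFun 0 ∪ fuzzyCut v.toFun 0)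
    ((u.fuzzyCut_nonempty 0).inl) (u.compactSupport.union v.compactSupport)
  exact S.eventually_within hd hS hE hinv (fun x hx => hsub (Or.inl (mem_fuzzyCut_zero hx)))
    (fun x hx => hsub (Or.inr (mem_fuzzyCut_zero hx))) hε

/-! ### A directed admissible multimetric that keeps the contraction property -/

/-- The continuous pseudometrics with respect to which `S` is Edelstein contracting. -/
def edelsteinPseudometrics (S : FuzzyIFS X k) : Set (PseudoMetric X ℝ) :=
  {d | d.IsContinuous ∧ S.EdelsteinContracting {d}}

theorem isDirectedFamily_edelsteinPseudometrics (S : FuzzyIFS X k) :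
    IsDirectedFamily S.edelsteinPseudometrics := by
  refine IsDirectedFamily.of_sup_mem fun d hd e he => ⟨Continuous.max hd.1 he.1, ?_⟩
  rintro _ rfl i
  obtain ⟨hd1, hd2⟩ := hd.2 d rfl i
  obtain ⟨he1, he2⟩ := he.2 e rfl i
  simp only [PseudoMetric.sup_apply]
  refine ⟨fun x y => max_le_max (hd1 x y) (he1 x y), fun x y hxy => max_lt ?_ ?_⟩
  · rcases (d.nonneg x y).eq_or_lt with h | h
    · exact (hd1 x y).trans_lt (h ▸ hxy)
    · exact (hd2 x y h).trans_le (le_max_left _ _)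
  · rcases (e.nonneg x y).eq_or_lt with h | h
    · exact (he1 x y).trans_lt (h ▸ hxy)
    · exact (he2 x y h).trans_le (le_max_right _ _)

theorem isAdmissibleMultimetric_edelsteinPseudometrics (S : FuzzyIFS X k)
    {D : Set (PseudoMetric X ℝ)} (hD : IsAdmissibleMultimetric D) (hS : S.EdelsteinContracting D) :
    IsAdmissibleMultimetric S.edelsteinPseudometrics :=
  hD.mono (fun d hd => ⟨hD.isContinuous hd, fun _ he => he ▸ hS d hd⟩) fun _ hd => hd.1

end FuzzyIFS

/-! ### The main theorem -/

theorem theorem3p8 {X : Type*} [TopologicalSpace X] [T35Space X] [Nonempty X] {k : ℕ}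
    (S : FuzzyIFS X k) (hdom : S.CompactlyDominating)
    (hcontr : ∃ D : Set (PseudoMetric X ℝ), IsAdmissibleMultimetric D ∧ S.EdelsteinContracting D) :
    ∃ T : TopologicalSpace (CompactFuzzySet X), IsMTopology T ∧
      ∃! u : CompactFuzzySet X, S.IsFuzzyAttractor T u := by
  obtain ⟨D, hD, hS⟩ := hcontr
  have hadm := S.isAdmissibleMultimetric_edelsteinPseudometrics hD hS
  have hdir := S.isDirectedFamily_edelsteinPseudometrics
  refine ⟨fuzzyTopology S.edelsteinPseudometrics, isMTopology_fuzzyTopology hadm hdir, ?_⟩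
  have hlim {u : CompactFuzzySet X} (hu : S.hutchinson u = u) (v : CompactFuzzySet X)
      {d : PseudoMetric X ℝ} (hd : d ∈ S.edelsteinPseudometrics) {ε : ℝ} (hε : 0 < ε) :
      ∀ᶠ n in atTop, Within d ε u (S.hutchinson^[n] v) ∧ Within d ε (S.hutchinson^[n] v) u := by
    have hfix (n : ℕ) : S.hutchinson^[n] u = u := Function.iterate_fixed hu n
    simpa only [hfix] using
      (S.eventually_within_of_compactlyDominating hdom hd.1 hd.2 u v hε).and
        (S.eventually_within_of_compactlyDominating hdom hd.1 hd.2 v u hε)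
  obtain ⟨E, hne, hE, -, hinv⟩ := hdom {Classical.arbitrary X} (singleton_nonempty _)
    isCompact_singleton
  obtain ⟨u, hu⟩ := S.exists_hutchinson_eq_self hne hE hinv
  refine ⟨u, ⟨hu, fun v => tendsto_generatedTopology ?_⟩, ?_⟩
  · rintro ⟨d, hd⟩ ε hε
    filter_upwards [hlim hu v hd (half_pos hε)] with n hn
    exact (fuzzyHausdorffDist_le hd.1 hn.1 hn.2).trans_lt (half_lt_self hε)
  -- The orbit of `v` is constant too, so being a fixed point already forces `v = u`.
  · rintro v ⟨hv, -⟩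
    have hnear (d : PseudoMetric X ℝ) (hd : d ∈ S.edelsteinPseudometrics) (r : ℝ) (hr : 0 < r) :
        Within d r u v ∧ Within d r v u := by
      obtain ⟨n, hn⟩ := (hlim hu v hd hr).exists
      rwa [Function.iterate_fixed hv n] at hn
    exact CompactFuzzySet.ext (le_antisymm
      (toFun_le_of_within hadm hdir fun d hd r hr => (hnear d hd r hr).2)
      (toFun_le_of_within hadm hdir fun d hd r hr => (hnear d hd r hr).1))
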